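/- Let \(S=\{\frac1n,\rho_x\}_{x=1}^n\) be an equiprobable ensemble of \(n\) qubit states, with Bloch vectors \(\vec v_x\), i.e. \(\rho_x=\frac12(I+\vec v_x\cdot\vec\sigma)\). A POVM \(M=\{M_x\}_{x=1}^n\) is optimal for an ensemble \(\{q_x,\rho_x\}\) if it maximizes \(\sum_x q_x\,\mathrm{tr}(M_x\rho_x)\) over all POVMs with \(n\) outcomes; the maximum is the guessing probability \(P_g\). The discrimination problem is called nontrivial if no strategy "always guess \(\rho_j\)" (that is, \(M_x=\delta_{jx}I\)) is optimal. A channel \(\mathcal N\) (a completely positive trace preserving map) preserves an optimal measurement \(M\) of \(S\) if \(M\) is also optimal for \(S^{(\mathcal N)}=\{\frac1n,\mathcal N(\rho_x)\}_{x=1}^n\); it is OMP for \(S\) if it preserves every optimal measurement of \(S\). Let \(\delta_{\mathcal N}=P_g-P_g^{(\mathcal N)}\), where \(P_g^{(\mathcal N)}\) is the guessing probability of \(S^{(\mathcal N)}\). (1) Assume that the discrimination problem for \(S\) is nontrivial and that for each \(x\) some optimal measurement of \(S\) has \(M_x\neq0\). Let \(\mathcal N\) be a qubit channel with Bloch representation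 \((D,\vec t\,)\), i.e. \(\mathcal N(\frac12(I+\vec v\cdot\vec\sigma))=\frac12(I+(D\vec v+\vec t\,)\cdot\vec\sigma)\) with \(D\) a real \(3\times3\) matrix and \(\vec t\in\mathbb R^3\). Then the following are equivalent: - \(\mathcal N\) is OMP for \(S\) and the discrimination problem for \(S^{(\mathcal N)}\) is nontrivial; - there is \(\kappa\in(0,1]\) with \(\vec v_x-\vec v_y\in\ker(D-\kappa I)\) for all \(x,y\). The same equivalence holds when, in the first condition, "\(\mathcal N\) is OMP" is replaced by "\(\mathcal N\) preserves \(M\)", for any given optimal measurement \(M\) of \(S\) with \(M_x\ne0\) for all \(x\). Moreover \(P_g>\frac1n\), and any such \(\kappa\) equals \(1-\delta_{\mathcal N}/(P_g-\frac1n)\); in particular \(\kappa=1-n\delta_{\mathcal N}\) if \(P_g=\frac2n\). (2) For every equiprobable ensemble \(S\), every channel of the form \(\Lambda(\frac12(I+\vec v\cdot\vec\sigma))=\frac12(I+(\kappa\vec v+\vec t\,)\cdot\vec\sigma)\) with \(0<\kappa\le1\) is OMP for \(S\), and the discrimination problem for \(S^{(\Lambda)}\) is nontrivial if that for \(S\)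 is. This includes the depolarizing channels \(\rho\mapsto(1-\eta)\rho+\eta\frac I2\), \(0\le\eta<1\), which are indeed channels, with \(\kappa=1-\eta\) and \(\vec t=0\). -/

import Mathlib

open scoped Matrix ComplexOrder

/-- Operators on the qubit Hilbert space `ℂ²`. -/
abbrev QubitOp : Type := Matrix (Fin 2) (Fin 2) ℂ

/-- A quantum state: positive semidefinite (hence Hermitian) with trace one. -/
structure IsState (ρ : QubitOp) : Prop where
  posSemidef : ρ.PosSemidef
  trace_eq_one : ρ.trace = 1

/-- The Pauli matrices. -/
def pauli : Fin 3 → QubitOp :=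
  ![!![0, 1; 1, 0], !![0, -Complex.I; Complex.I, 0], !![1, 0; 0, -1]]

/-- The operator `½ (I + v · σ)` with Bloch vector `v`. -/
noncomputable def blochOp (v : Fin 3 → ℝ) : QubitOp :=
  (1 / 2 : ℂ) • (1 + ∑ i, (v i : ℂ) • pauli i)

/-- An ensemble of `n` qubit states with their a priori probabilities. -/
structure Ensemble (n : ℕ) where
  prob : Fin n → ℝ
  state : Fin n → QubitOp
  prob_nonneg : ∀ x, 0 ≤ prob x
  prob_sum : ∑ x, prob x = 1
  isState : ∀ x, IsState (state x)

/-- A measurement (POVM) with `n` outcomes; some of its elements may be zero. -/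
structure IsPOVM {n : ℕ} (M : Fin n → QubitOp) : Prop where
  posSemidef : ∀ x, (M x).PosSemidef
  sum_eq_one : ∑ x, M x = 1

/-- Complete positivity: `id_k ⊗ N` preserves positive semidefiniteness for every `k`. -/
def IsCompletelyPositive (N : QubitOp →ₗ[ℂ] QubitOp) : Prop :=
  ∀ (k : ℕ) (X : Matrix (Fin k × Fin 2) (Fin k × Fin 2) ℂ), X.PosSemidef →
    (Matrix.of fun p q : Fin k × Fin 2 =>
      N (Matrix.of fun a b => X (p.1, a) (q.1, b)) p.2 q.2).PosSemidef

/-- A qubit channel: a completely positive, trace preserving linear map. -/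
structure IsChannel (N : QubitOp →ₗ[ℂ] QubitOp) : Prop where
  completelyPositive : IsCompletelyPositive N
  tracePreserving : ∀ X, (N X).trace = X.trace

theorem IsChannel.map_isState {N : QubitOp →ₗ[ℂ] QubitOp} (hN : IsChannel N)
    {ρ : QubitOp} (hρ : IsState ρ) : IsState (N ρ) := by
  refine ⟨?_, by rw [hN.tracePreserving, hρ.trace_eq_one]⟩
  have h := hN.completelyPositive 1 (ρ.submatrix Prod.snd Prod.snd)
    (hρ.posSemidef.submatrix _)
  exact h.submatrix (fun a : Fin 2 => ((0 : Fin 1), a))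

/-- `N` acts on Bloch vectors as `v ↦ D v + t`. -/
def HasBlochRep (N : QubitOp →ₗ[ℂ] QubitOp) (D : Matrix (Fin 3) (Fin 3) ℝ)
    (t : Fin 3 → ℝ) : Prop :=
  ∀ v : Fin 3 → ℝ, v ⬝ᵥ v ≤ 1 → N (blochOp v) = blochOp (D *ᵥ v + t)

/-- The depolarizing map, `ρ ↦ (1 - η) ρ + η I / 2` on states. -/
noncomputable def depolarizing (η : ℝ) : QubitOp →ₗ[ℂ] QubitOp :=
  ((1 - η : ℝ) : ℂ) • LinearMap.id +
    ((η / 2 : ℝ) : ℂ) • (Matrix.traceLinearMap (Fin 2) ℂ ℂ).smulRight (1 : QubitOp)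

namespace Ensemble

variable {n : ℕ}

/-- The ensemble of the states after the use of a channel. -/
def map (S : Ensemble n) (N : QubitOp →ₗ[ℂ] QubitOp) (hN : IsChannel N) : Ensemble n where
  prob := S.prob
  state x := N (S.state x)
  prob_nonneg := S.prob_nonneg
  prob_sum := S.prob_sum
  isState x := hN.map_isState (S.isState x)

/-- The average probability of a correct guess with the measurement `M`. -/
noncomputable def successProb (S : Ensemble n) (M : Fin n → QubitOp) : ℝ :=
  ∑ x, S.prob x * ((M x * S.state x).trace).re

/-- `M` solves the minimum error discrimination problem for `S`. -/
def IsOptimal (S : Ensemble n) (M : Fin n → QubitOp) : Prop :=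
  IsPOVM M ∧ ∀ M' : Fin n → QubitOp, IsPOVM M' → S.successProb M' ≤ S.successProb M

/-- The guessing probability: the optimal success probability over all POVMs. -/
noncomputable def guessProb (S : Ensemble n) : ℝ :=
  sSup {p : ℝ | ∃ M : Fin n → QubitOp, IsPOVM M ∧ p = S.successProb M}

/-- The measurement-free strategy that always guesses `j` (the POVM with `M_j = I`). -/
def alwaysGuess (j : Fin n) : Fin n → QubitOp := fun x => if x = j then 1 else 0

/-- Discrimination is nontrivial: no strategy that always guesses the same state is optimal. -/
def IsNontrivial (S : Ensemble n) : Prop := ∀ j : Fin n, ¬ S.IsOptimal (alwaysGuess j)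

/-- Every state of the ensemble is identified by some optimal measurement. -/
def AllIdentified (S : Ensemble n) : Prop :=
  ∀ x, ∃ M : Fin n → QubitOp, S.IsOptimal M ∧ M x ≠ 0

/-- All a priori probabilities are equal. -/
def Equiprobable (S : Ensemble n) : Prop := ∀ x, S.prob x = 1 / (n : ℝ)

/-- The guessing degradation `P_g - P_g^(N)`. -/
noncomputable def degradation (S : Ensemble n) (N : QubitOp →ₗ[ℂ] QubitOp)
    (hN : IsChannel N) : ℝ :=
  S.guessProb - (S.map N hN).guessProb

/-- The measurement `M` is optimal for the ensemble both before and after the channel use. -/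
def Preserves (S : Ensemble n) (N : QubitOp →ₗ[ℂ] QubitOp) (hN : IsChannel N)
    (M : Fin n → QubitOp) : Prop :=
  S.IsOptimal M ∧ (S.map N hN).IsOptimal M

/-- The channel is (strongly) optimal measurement preserving: every measurement that solves the
discrimination problem for `S` also solves it after the channel use. -/
def IsOMP (S : Ensemble n) (N : QubitOp →ₗ[ℂ] QubitOp) (hN : IsChannel N) : Prop :=
  ∀ M : Fin n → QubitOp, S.IsOptimal M → S.Preserves N hN M

end Ensemble

/-- `κ ∈ (0, 1]` and all differences of the Bloch vectors `v x` lie in `ker (D - κ I)`. -/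
def KernelCondition {n : ℕ} (D : Matrix (Fin 3) (Fin 3) ℝ) (v : Fin n → Fin 3 → ℝ)
    (κ : ℝ) : Prop :=
  κ ∈ Set.Ioc (0 : ℝ) 1 ∧
    ∀ x y, v x - v y ∈ LinearMap.ker (Matrix.toLin' (D - κ • (1 : Matrix (Fin 3) (Fin 3) ℝ)))

/-!
A qubit operator `a I + b · σ` is positive semidefinite iff `‖b‖ ≤ a`. A POVM is thus a family of
vectors `b x` with sum zero, together with weights of total one that dominate their norms, and for
equiprobable states `n P_g - 1` is the maximum `F` of the linear functional `∑ x, ⟪b x, v x⟫`. By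
homogeneity `F ∑ x, ‖c x‖ - ∑ x, ⟪c x, v x⟫ ≥ 0` for every family `c` with sum zero, and an optimal
POVM of a nontrivial problem attains equality. If none of its elements vanishes, the left hand side
is differentiable there, and stationarity says that
`v x - v y = F (b x / ‖b x‖ - b y / ‖b y‖)`. The directions on the right belong to the measurement
alone, so a channel for which it stays optimal multiplies all the differences `v x - v y` by the
ratio of the values of `F` after and before. Conversely, multiplying all the differences by `κ > 0`
multiplies the functional by `κ`, which does not move its maximizers.
-/

section InnerProductSpace

variable {ι E : Type*} [Fintype ι] [NormedAddCommGroup E] [InnerProductSpace ℝ E]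

theorem hasDerivAt_norm_comp {f : ℝ → E} {f' : E} {t : ℝ} (hf : HasDerivAt f f' t)
    (h0 : f t ≠ 0) : HasDerivAt (fun s => ‖f s‖) (inner ℝ (NormedSpace.normalize (f t)) f') t := by
  have hsq : ‖f t‖ ^ 2 ≠ 0 := pow_ne_zero 2 (norm_ne_zero_iff.mpr h0)
  convert hf.norm_sq.sqrt hsq using 1
  · simp only [Real.sqrt_sq (norm_nonneg _)]
  · rw [Real.sqrt_sq (norm_nonneg _), NormedSpace.normalize, real_inner_smul_left]
    field_simp

theorem eq_of_forall_sum_inner_eq_zero {g : ι → E}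
    (hg : ∀ h : ι → E, ∑ x, h x = 0 → ∑ x, inner ℝ (g x) (h x) = 0) (x y : ι) : g x = g y := by
  classical
  have hsingle (z : ι) (d : E) :
      ∑ x, inner ℝ (g x) ((Pi.single z d : ι → E) x) = inner ℝ (g z) d := by
    simp only [Pi.apply_single (fun x => inner ℝ (g x)) fun _ => inner_zero_right _,
      Finset.sum_pi_single', Finset.mem_univ, if_true]
  refine ext_inner_right ℝ fun d => sub_eq_zero.mp ?_
  have h := hg (fun z => (Pi.single x d : ι → E) z - (Pi.single y d : ι → E) z)
    (by simp [Finset.sum_sub_distrib])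
  simpa only [inner_sub_right, Finset.sum_sub_distrib, inner_sub_left, hsingle] using h

theorem hasLineDerivAt_mul_sum_norm_sub_sum_inner {b : ι → E} (hne : ∀ x, b x ≠ 0) (F : ℝ)
    (v h : ι → E) :
    HasLineDerivAt ℝ (fun c : ι → E => F * ∑ x, ‖c x‖ - ∑ x, inner ℝ (c x) (v x))
      (∑ x, inner ℝ (F • NormedSpace.normalize (b x) - v x) (h x)) b h := by
  have hline (x : ι) : HasDerivAt (fun t : ℝ => b x + t • h x) (h x) 0 := by
    simpa using ((hasDerivAt_id (0 : ℝ)).smul_const (h x)).const_add (b x)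
  have hnorm (x : ι) : HasDerivAt (fun t : ℝ => ‖b x + t • h x‖)
      (inner ℝ (NormedSpace.normalize (b x)) (h x)) 0 := by
    simpa using hasDerivAt_norm_comp (hline x) (by simpa using hne x)
  have hinner (x : ι) : HasDerivAt (fun t : ℝ => inner ℝ (b x + t • h x) (v x))
      (inner ℝ (v x) (h x)) 0 := by
    simpa [real_inner_comm] using (hline x).inner ℝ (hasDerivAt_const 0 (v x))
  simp only [inner_sub_left, real_inner_smul_left, Finset.sum_sub_distrib, ← Finset.mul_sum]
  exact ((HasDerivAt.fun_sum fun x _ => hnorm x).const_mul F).sub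
    (HasDerivAt.fun_sum fun x _ => hinner x)

theorem sub_eq_smul_normalize_sub_of_forall_sum_inner_le {v b : ι → E} {F : ℝ} (hb : ∑ x, b x = 0)
    (hne : ∀ x, b x ≠ 0)
    (hmax : ∀ c : ι → E, ∑ x, c x = 0 → ∑ x, inner ℝ (c x) (v x) ≤ F * ∑ x, ‖c x‖)
    (heq : ∑ x, inner ℝ (b x) (v x) = F * ∑ x, ‖b x‖) (x y : ι) :
    v x - v y = F • (NormedSpace.normalize (b x) - NormedSpace.normalize (b y)) := by
  have hmin : IsMinOn (fun c : ι → E => F * ∑ x, ‖c x‖ - ∑ x, inner ℝ (c x) (v x))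
      {c | ∑ x, c x = 0} b := by
    refine isMinOn_iff.mpr fun c hc => ?_
    rw [heq, sub_self]
    exact sub_nonneg.mpr (hmax c hc)
  have hstat (h : ι → E) (hh : ∑ x, h x = 0) :
      ∑ x, inner ℝ (F • NormedSpace.normalize (b x) - v x) (h x) = 0 := by
    refine hmin.hasLineDerivAt_eq_zero (hasLineDerivAt_mul_sum_norm_sub_sum_inner hne F v h)
      (Filter.Eventually.of_forall fun t => ?_)
    simp [Finset.sum_add_distrib, ← Finset.smul_sum, hb, hh]
  have hconst := eq_of_forall_sum_inner_eq_zero hstat x y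
  rw [smul_sub, sub_eq_sub_iff_sub_eq_sub, ← neg_sub, hconst, neg_sub]

theorem sum_inner_eq_mul_of_sub_eq_smul {b v w : ι → E} {κ : ℝ} (hb : ∑ x, b x = 0)
    (hvw : ∀ x y, w x - w y = κ • (v x - v y)) :
    ∑ x, inner ℝ (b x) (w x) = κ * ∑ x, inner ℝ (b x) (v x) := by
  rcases isEmpty_or_nonempty ι with hι | ⟨⟨o⟩⟩
  · simp
  have hw (x : ι) : w x = κ • v x + (w o - κ • v o) := by
    rw [add_sub_left_comm, ← smul_sub, ← hvw, add_sub_cancel]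
  rw [Finset.sum_congr rfl fun x _ => congrArg (inner ℝ (b x)) (hw x)]
  simp only [inner_add_right, real_inner_smul_right, Finset.sum_add_distrib, ← Finset.mul_sum,
    ← sum_inner, hb, inner_zero_left, add_zero]

end InnerProductSpace

theorem posSemidef_fin_two_iff {𝕜 : Type*} [RCLike 𝕜] {A : Matrix (Fin 2) (Fin 2) 𝕜}
    (hA : A.IsHermitian) : A.PosSemidef ↔ 0 ≤ A.trace ∧ 0 ≤ A.det := by
  refine ⟨fun h => ⟨h.trace_nonneg, h.det_nonneg⟩, fun ⟨htr, hdet⟩ => ?_⟩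
  rw [hA.trace_eq_sum_eigenvalues, Fin.sum_univ_two] at htr
  rw [hA.det_eq_prod_eigenvalues, Fin.prod_univ_two] at hdet
  norm_cast at htr hdet
  rw [hA.posSemidef_iff_eigenvalues_nonneg, Pi.le_def, Fin.forall_fin_two]
  constructor <;> simp only [Pi.zero_apply] <;> nlinarith

/-- Bloch vectors with their Euclidean norm (`Fin 3 → ℝ` itself carries the sup norm). -/
abbrev BlochSpace : Type := EuclideanSpace ℝ (Fin 3)

/-- The Hermitian operator `a I + b · σ` with Pauli coordinates `(a, b)`. -/
noncomputable def hermOp : ℝ × BlochSpace →ₗ[ℝ] QubitOp where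
  toFun p := p.1 • 1 + ∑ i, p.2 i • pauli i
  map_add' p q := by
    simp only [Prod.fst_add, Prod.snd_add, PiLp.add_apply, add_smul, Finset.sum_add_distrib]
    abel
  map_smul' c p := by simp [smul_smul, Finset.smul_sum]

/-- The vector part `b` of the Pauli coordinates of an operator `A`, read off as
`b i = re (tr (A σ i)) / 2`; the Bloch vector of a state is twice this vector. -/
noncomputable def pauliVec : QubitOp →ₗ[ℝ] BlochSpace where
  toFun A := WithLp.toLp 2 fun i => (A * pauli i).trace.re / 2
  map_add' A B := by ext; simp [add_mul, add_div]
  map_smul' c A := by ext; simp [mul_div_assoc]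

theorem hermOp_one_zero : hermOp (1, 0) = 1 := by simp [hermOp]

theorem hermOp_eq_matrix (p : ℝ × BlochSpace) :
    hermOp p = !![(p.1 + p.2 2 : ℂ), p.2 0 - p.2 1 * Complex.I;
      p.2 0 + p.2 1 * Complex.I, p.1 - p.2 2] := by
  ext i j
  fin_cases i <;> fin_cases j <;> simp [hermOp, pauli, Fin.sum_univ_three] <;> ring

theorem isHermitian_hermOp (p : ℝ × BlochSpace) : (hermOp p).IsHermitian := by
  rw [hermOp_eq_matrix]
  ext i j
  fin_cases i <;> fin_cases j <;> simp; ring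

theorem trace_hermOp (p : ℝ × BlochSpace) : (hermOp p).trace = (2 * p.1 : ℝ) := by
  rw [hermOp_eq_matrix, Matrix.trace_fin_two_of]
  push_cast
  ring

theorem det_hermOp (p : ℝ × BlochSpace) : (hermOp p).det = (p.1 ^ 2 - ‖p.2‖ ^ 2 : ℝ) := by
  rw [hermOp_eq_matrix, Matrix.det_fin_two_of, EuclideanSpace.real_norm_sq_eq, Fin.sum_univ_three]
  push_cast
  linear_combination (p.2 1 : ℂ) ^ 2 * Complex.I_sq

theorem pauliVec_hermOp (p : ℝ × BlochSpace) : pauliVec (hermOp p) = p.2 := by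
  ext i
  fin_cases i <;>
    simp [hermOp_eq_matrix, pauliVec, pauli, Matrix.trace_fin_two, Matrix.mul_apply]; ring

theorem pauliVec_one : pauliVec 1 = 0 := by
  rw [← hermOp_one_zero, pauliVec_hermOp]

theorem hermOp_trace_pauliVec {A : QubitOp} (hA : A.IsHermitian) :
    hermOp (A.trace.re / 2, pauliVec A) = A := by
  have h01 : A 0 1 = star (A 1 0) := (hA.apply 0 1).symm
  have him (i : Fin 2) : (A i i).im = 0 := Complex.conj_eq_iff_im.mp (hA.apply i i)
  rw [hermOp_eq_matrix]
  ext i j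
  fin_cases i <;> fin_cases j <;> apply Complex.ext <;>
    simp [pauliVec, pauli, Matrix.trace_fin_two, Matrix.mul_apply, h01, him] <;> ring

theorem posSemidef_hermOp_iff {a : ℝ} {b : BlochSpace} :
    (hermOp (a, b)).PosSemidef ↔ ‖b‖ ≤ a := by
  rw [posSemidef_fin_two_iff (isHermitian_hermOp (a, b)), trace_hermOp, det_hermOp,
    Complex.zero_le_real, Complex.zero_le_real, sub_nonneg]
  refine ⟨fun ⟨htr, hsq⟩ => ?_, fun h => ?_⟩
  · exact (sq_le_sq₀ (norm_nonneg _) (by linarith only [htr])).mp hsq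
  · have ha : 0 ≤ a := (norm_nonneg b).trans h
    exact ⟨by linarith, pow_le_pow_left₀ (norm_nonneg b) h 2⟩

theorem norm_pauliVec_le {A : QubitOp} (hA : A.PosSemidef) : ‖pauliVec A‖ ≤ A.trace.re / 2 :=
  posSemidef_hermOp_iff.mp ((hermOp_trace_pauliVec hA.isHermitian).symm ▸ hA)

theorem re_trace_mul_blochOp (A : QubitOp) (v : Fin 3 → ℝ) :
    (A * blochOp v).trace.re = A.trace.re / 2 + inner ℝ (pauliVec A) (WithLp.toLp 2 v) := by
  have htrace : (A * blochOp v).trace =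
      (1 / 2 : ℝ) * (A.trace + ∑ i, (v i : ℂ) * (A * pauli i).trace) := by
    simp [blochOp, mul_add, Finset.mul_sum, Matrix.trace_sum]
  have hinner : inner ℝ (pauliVec A) (WithLp.toLp 2 v) =
      1 / 2 * ∑ i, v i * (A * pauli i).trace.re := by
    simp only [pauliVec, LinearMap.coe_mk, AddHom.coe_mk, PiLp.inner_apply, Finset.mul_sum,
      Real.inner_apply]
    exact Finset.sum_congr rfl fun i _ => by ring
  rw [htrace, hinner, Complex.re_ofReal_mul, Complex.add_re, Complex.re_sum]
  simp only [Complex.re_ofReal_mul]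
  ring

theorem blochOp_eq_hermOp (v : Fin 3 → ℝ) :
    blochOp v = hermOp (1 / 2, (1 / 2 : ℝ) • WithLp.toLp 2 v) := by
  rw [hermOp_eq_matrix]
  ext i j
  fin_cases i <;> fin_cases j <;> simp [blochOp, pauli, Fin.sum_univ_three] <;> ring

theorem isState_blochOp_iff {v : Fin 3 → ℝ} :
    IsState (blochOp v) ↔ ‖(WithLp.toLp 2 v : BlochSpace)‖ ≤ 1 := by
  have htrace : (blochOp v).trace = 1 := by simp [blochOp_eq_hermOp, trace_hermOp]
  have hpos : (blochOp v).PosSemidef ↔ ‖(WithLp.toLp 2 v : BlochSpace)‖ ≤ 1 := by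
    rw [blochOp_eq_hermOp, posSemidef_hermOp_iff, norm_smul, Real.norm_of_nonneg one_half_pos.le,
      mul_le_iff_le_one_right one_half_pos]
  exact ⟨fun h => hpos.mp h.posSemidef, fun h => ⟨hpos.mpr h, htrace⟩⟩

theorem IsState.exists_blochOp {ρ : QubitOp} (hρ : IsState ρ) :
    ∃ v : Fin 3 → ℝ, ρ = blochOp v := by
  refine ⟨WithLp.ofLp ((2 : ℝ) • pauliVec ρ), ?_⟩
  rw [blochOp_eq_hermOp, WithLp.toLp_ofLp, smul_smul, one_div_mul_cancel two_ne_zero, one_smul]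
  simpa [hρ.trace_eq_one] using (hermOp_trace_pauliVec hρ.posSemidef.isHermitian).symm

theorem isPOVM_alwaysGuess {n : ℕ} (j : Fin n) : IsPOVM (Ensemble.alwaysGuess j) where
  posSemidef x := by
    unfold Ensemble.alwaysGuess
    split_ifs
    exacts [Matrix.PosSemidef.one, Matrix.PosSemidef.zero]
  sum_eq_one := by simp [Ensemble.alwaysGuess]

theorem isPOVM_hermOp_norm {n : ℕ} {c : Fin n → BlochSpace} (hc : ∑ x, c x = 0)
    (h1 : ∑ x, ‖c x‖ = 1) : IsPOVM fun x => hermOp (‖c x‖, c x) where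
  posSemidef _ := posSemidef_hermOp_iff.mpr le_rfl
  sum_eq_one := by rw [← map_sum, ← prod_mk_sum, h1, hc, hermOp_one_zero]

theorem convex_setOf_isPOVM {n : ℕ} : Convex ℝ {M : Fin n → QubitOp | IsPOVM M} := by
  rintro M hM M' hM' a b ha hb hab
  refine ⟨fun x => ((hM.posSemidef x).smul ha).add ((hM'.posSemidef x).smul hb), ?_⟩
  simp only [Pi.add_apply, Pi.smul_apply, Finset.sum_add_distrib, ← Finset.smul_sum,
    hM.sum_eq_one, hM'.sum_eq_one, ← add_smul, hab, one_smul]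

namespace IsPOVM

variable {n : ℕ} {M : Fin n → QubitOp}

theorem sum_pauliVec (hM : IsPOVM M) : ∑ x, pauliVec (M x) = 0 := by
  rw [← map_sum, hM.sum_eq_one, pauliVec_one]

theorem sum_trace_re (hM : IsPOVM M) : ∑ x, (M x).trace.re / 2 = 1 := by
  rw [← Finset.sum_div, ← Complex.re_sum, ← Matrix.trace_sum, hM.sum_eq_one]
  simp

end IsPOVM

/-- The total overlap of the measurement directions of `M` with the Bloch vectors `v`: for an
equiprobable ensemble of `n` states it is `n` times the gain of `M` over a random guess. -/
noncomputable def blochGain {n : ℕ} (v : Fin n → Fin 3 → ℝ) (M : Fin n → QubitOp) : ℝ :=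
  ∑ x, inner ℝ (pauliVec (M x)) (WithLp.toLp 2 (v x))

theorem blochGain_eq_mul {n : ℕ} {v w : Fin n → Fin 3 → ℝ} {κ : ℝ} {M : Fin n → QubitOp}
    (hM : IsPOVM M) (hvw : ∀ x y, w x - w y = κ • (v x - v y)) :
    blochGain w M = κ * blochGain v M :=
  sum_inner_eq_mul_of_sub_eq_smul hM.sum_pauliVec fun x y => congrArg (WithLp.toLp 2) (hvw x y)

namespace Ensemble

variable {n : ℕ} {S S' : Ensemble n} {v w : Fin n → Fin 3 → ℝ} {M : Fin n → QubitOp}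

theorem card_pos (S : Ensemble n) : 0 < n := by
  rcases Nat.eq_zero_or_pos n with rfl | h
  · simpa using S.prob_sum
  · exact h

theorem exists_blochOp (S : Ensemble n) :
    ∃ v : Fin n → Fin 3 → ℝ, ∀ x, S.state x = blochOp (v x) := by
  choose v hv using fun x => (S.isState x).exists_blochOp
  exact ⟨v, hv⟩

theorem successProb_eq (hS : S.Equiprobable) (hv : ∀ x, S.state x = blochOp (v x))
    (hM : IsPOVM M) : S.successProb M = 1 / n * (1 + blochGain v M) := by
  simp only [successProb, hS _, hv, re_trace_mul_blochOp, ← Finset.mul_sum,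
    Finset.sum_add_distrib, hM.sum_trace_re, blochGain]

theorem successProb_le_iff (hS : S.Equiprobable) (hv : ∀ x, S.state x = blochOp (v x))
    {M' : Fin n → QubitOp} (hM : IsPOVM M) (hM' : IsPOVM M') :
    S.successProb M ≤ S.successProb M' ↔ blochGain v M ≤ blochGain v M' := by
  have hn : (0 : ℝ) < 1 / n := one_div_pos.mpr (Nat.cast_pos.mpr S.card_pos)
  rw [successProb_eq hS hv hM, successProb_eq hS hv hM', mul_le_mul_iff_right₀ hn,
    add_le_add_iff_left]

theorem isOptimal_iff_blochGain (hS : S.Equiprobable) (hv : ∀ x, S.state x = blochOp (v x)) :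
    S.IsOptimal M ↔ IsPOVM M ∧ ∀ M', IsPOVM M' → blochGain v M' ≤ blochGain v M :=
  and_congr_right fun hM => forall₂_congr fun _ hM' => successProb_le_iff hS hv hM' hM

theorem blochGain_alwaysGuess (v : Fin n → Fin 3 → ℝ) (j : Fin n) :
    blochGain v (alwaysGuess j) = 0 := by
  simp [blochGain, alwaysGuess, apply_ite pauliVec, pauliVec_one]

theorem IsOptimal.guessProb_eq (hM : S.IsOptimal M) : S.guessProb = S.successProb M := by
  refine IsGreatest.csSup_eq ⟨⟨M, hM.1, rfl⟩, ?_⟩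
  rintro p ⟨M', hM', rfl⟩
  exact hM.2 M' hM'

theorem IsNontrivial.blochGain_pos (hnt : S.IsNontrivial) (hS : S.Equiprobable)
    (hv : ∀ x, S.state x = blochOp (v x)) (hM : S.IsOptimal M) : 0 < blochGain v M := by
  by_contra! h
  let j : Fin n := ⟨0, S.card_pos⟩
  refine hnt j ((isOptimal_iff_blochGain hS hv).mpr ⟨isPOVM_alwaysGuess j, fun M' hM' => ?_⟩)
  rw [blochGain_alwaysGuess]
  exact (((isOptimal_iff_blochGain hS hv).mp hM).2 M' hM').trans h

theorem IsOptimal.guessProb_eq_blochGain (hM : S.IsOptimal M) (hS : S.Equiprobable)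
    (hv : ∀ x, S.state x = blochOp (v x)) : S.guessProb = 1 / n * (1 + blochGain v M) := by
  rw [hM.guessProb_eq, successProb_eq hS hv hM.1]

theorem IsNontrivial.one_div_lt_guessProb (hnt : S.IsNontrivial) (hS : S.Equiprobable)
    (hM : S.IsOptimal M) : 1 / (n : ℝ) < S.guessProb := by
  obtain ⟨v, hv⟩ := S.exists_blochOp
  have hn : (0 : ℝ) < 1 / n := one_div_pos.mpr (Nat.cast_pos.mpr S.card_pos)
  rw [hM.guessProb_eq_blochGain hS hv]
  exact lt_mul_of_one_lt_right hn (lt_add_of_pos_right 1 (hnt.blochGain_pos hS hv hM))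

theorem isLinearMap_successProb (S : Ensemble n) : IsLinearMap ℝ S.successProb where
  map_add M M' := by simp [successProb, add_mul, mul_add, Finset.sum_add_distrib]
  map_smul c M := by simp [successProb, Finset.mul_sum, mul_left_comm]

theorem convex_setOf_isOptimal (S : Ensemble n) : Convex ℝ {M | S.IsOptimal M} := by
  rintro M hM M' hM' a b ha hb hab
  refine ⟨convex_setOf_isPOVM hM.1 hM'.1 ha hb hab, fun L hL => ?_⟩
  have hlin := S.isLinearMap_successProb
  calc S.successProb L = a * S.successProb L + b * S.successProb L := by
        rw [← add_mul, hab, one_mul]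
    _ ≤ a * S.successProb M + b * S.successProb M' := by
        gcongr
        exacts [hM.2 L hL, hM'.2 L hL]
    _ = S.successProb (a • M + b • M') := by
        rw [hlin.map_add, hlin.map_smul, hlin.map_smul, smul_eq_mul, smul_eq_mul]

open scoped MatrixOrder in
theorem AllIdentified.exists_isOptimal (h : S.AllIdentified) :
    ∃ M : Fin n → QubitOp, S.IsOptimal M ∧ ∀ x, M x ≠ 0 := by
  choose M hM hne using h
  have hn : (0 : ℝ) < (n : ℝ)⁻¹ := inv_pos.mpr (Nat.cast_pos.mpr S.card_pos)
  refine ⟨∑ y, (n : ℝ)⁻¹ • M y, S.convex_setOf_isOptimal.sum_mem (fun _ _ => hn.le) ?_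
    fun y _ => hM y, fun x hx => hne x ?_⟩
  · simp [(Nat.cast_pos.mpr S.card_pos).ne']
  · have hnonneg (y : Fin n) : 0 ≤ (n : ℝ)⁻¹ • M y x :=
      (((hM y).1.posSemidef x).smul hn.le).nonneg
    simp only [Finset.sum_apply, Pi.smul_apply] at hx
    rw [Finset.sum_eq_zero_iff_of_nonneg fun y _ => hnonneg y] at hx
    exact (smul_eq_zero_iff_right hn.ne').mp (hx x (Finset.mem_univ x))

theorem IsOptimal.sum_inner_le (hM : S.IsOptimal M) (hS : S.Equiprobable)
    (hv : ∀ x, S.state x = blochOp (v x)) {c : Fin n → BlochSpace} (hc : ∑ x, c x = 0) :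
    ∑ x, inner ℝ (c x) (WithLp.toLp 2 (v x)) ≤ blochGain v M * ∑ x, ‖c x‖ := by
  have hs : 0 ≤ ∑ x, ‖c x‖ := Finset.sum_nonneg fun x _ => norm_nonneg (c x)
  set s := ∑ x, ‖c x‖ with hsdef
  rcases hs.eq_or_lt with h0 | h0
  · have hzero (x : Fin n) : c x = 0 := norm_eq_zero.mp <|
      (Finset.sum_eq_zero_iff_of_nonneg fun x _ => norm_nonneg (c x)).mp (hsdef.symm.trans h0.symm)
        x (Finset.mem_univ x)
    simp only [hzero, inner_zero_left, Finset.sum_const_zero, ← h0, mul_zero, le_rfl]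
  · have hsum : ∑ x, s⁻¹ • c x = 0 := by rw [← Finset.smul_sum, hc, smul_zero]
    have hnorm : ∑ x, ‖s⁻¹ • c x‖ = 1 := by
      simp only [norm_smul, Real.norm_of_nonneg (inv_nonneg.mpr h0.le), ← Finset.mul_sum,
        ← hsdef]
      exact inv_mul_cancel₀ h0.ne'
    have h := ((isOptimal_iff_blochGain hS hv).mp hM).2 _ (isPOVM_hermOp_norm hsum hnorm)
    simp only [blochGain, pauliVec_hermOp, real_inner_smul_left, ← Finset.mul_sum] at h
    rwa [inv_mul_le_iff₀' h0] at h

theorem IsOptimal.norm_pauliVec (hM : S.IsOptimal M) (hS : S.Equiprobable)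
    (hv : ∀ x, S.state x = blochOp (v x)) (hnt : S.IsNontrivial) (x : Fin n) :
    ‖pauliVec (M x)‖ = (M x).trace.re / 2 := by
  have hle (y : Fin n) : ‖pauliVec (M y)‖ ≤ (M y).trace.re / 2 :=
    norm_pauliVec_le (hM.1.posSemidef y)
  have hone : 1 ≤ ∑ y, ‖pauliVec (M y)‖ :=
    (le_mul_iff_one_le_right (hnt.blochGain_pos hS hv hM)).mp
      (hM.sum_inner_le hS hv hM.1.sum_pauliVec)
  exact (Finset.sum_eq_sum_iff_of_le fun y _ => hle y).mp
    ((Finset.sum_le_sum fun y _ => hle y).antisymm (hM.1.sum_trace_re.trans_le hone)) x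
    (Finset.mem_univ x)

theorem IsOptimal.sub_eq_smul_normalize_sub (hM : S.IsOptimal M) (hS : S.Equiprobable)
    (hv : ∀ x, S.state x = blochOp (v x)) (hnt : S.IsNontrivial) (hne : ∀ x, M x ≠ 0)
    (x y : Fin n) :
    WithLp.toLp 2 (v x) - WithLp.toLp 2 (v y) = blochGain v M •
      (NormedSpace.normalize (pauliVec (M x)) - NormedSpace.normalize (pauliVec (M y))) := by
  have hnorm := hM.norm_pauliVec hS hv hnt
  have hbne (z : Fin n) : pauliVec (M z) ≠ 0 := fun h0 => hne z <| by
    rw [← hermOp_trace_pauliVec (hM.1.posSemidef z).isHermitian, ← hnorm z, h0, norm_zero,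
      ← Prod.zero_eq_mk, map_zero]
  have hsum : ∑ z, ‖pauliVec (M z)‖ = 1 := by
    rw [← hM.1.sum_trace_re, Finset.sum_congr rfl fun z _ => hnorm z]
  refine sub_eq_smul_normalize_sub_of_forall_sum_inner_le hM.1.sum_pauliVec hbne
    (fun c hc => hM.sum_inner_le hS hv hc) ?_ x y
  rw [hsum, mul_one, blochGain]

theorem isOptimal_iff_of_sub_eq_smul (hS : S.Equiprobable) (hS' : S'.Equiprobable)
    (hv : ∀ x, S.state x = blochOp (v x)) (hw : ∀ x, S'.state x = blochOp (w x)) {κ : ℝ}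
    (hvw : ∀ x y, w x - w y = κ • (v x - v y)) (hκ : 0 < κ) :
    S'.IsOptimal M ↔ S.IsOptimal M := by
  rw [isOptimal_iff_blochGain hS' hw, isOptimal_iff_blochGain hS hv]
  refine and_congr_right fun hM => forall₂_congr fun M' hM' => ?_
  rw [blochGain_eq_mul hM hvw, blochGain_eq_mul hM' hvw, mul_le_mul_iff_right₀ hκ]

end Ensemble

theorem kernelCondition_iff {n : ℕ} {D : Matrix (Fin 3) (Fin 3) ℝ} {v : Fin n → Fin 3 → ℝ}
    {κ : ℝ} : KernelCondition D v κ ↔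
      κ ∈ Set.Ioc (0 : ℝ) 1 ∧ ∀ x y, D *ᵥ (v x - v y) = κ • (v x - v y) := by
  simp only [KernelCondition, LinearMap.mem_ker, Matrix.toLin'_apply, Matrix.sub_mulVec,
    Matrix.smul_mulVec, Matrix.one_mulVec, sub_eq_zero]

theorem kernelCondition_smul_one {n : ℕ} {κ : ℝ} (hκ : κ ∈ Set.Ioc (0 : ℝ) 1)
    (v : Fin n → Fin 3 → ℝ) : KernelCondition (κ • (1 : Matrix (Fin 3) (Fin 3) ℝ)) v κ :=
  kernelCondition_iff.mpr ⟨hκ, fun x y => by rw [Matrix.smul_mulVec, Matrix.one_mulVec]⟩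

theorem KernelCondition.sub_eq_smul {n : ℕ} {D : Matrix (Fin 3) (Fin 3) ℝ}
    {v : Fin n → Fin 3 → ℝ} {κ : ℝ} (hκ : KernelCondition D v κ) (t : Fin 3 → ℝ) (x y : Fin n) :
    (D *ᵥ v x + t) - (D *ᵥ v y + t) = κ • (v x - v y) := by
  rw [add_sub_add_right_eq_sub, ← Matrix.mulVec_sub, (kernelCondition_iff.mp hκ).2]

section Channel

variable {N : QubitOp →ₗ[ℂ] QubitOp} {D : Matrix (Fin 3) (Fin 3) ℝ} {t : Fin 3 → ℝ}

theorem HasBlochRep.map_blochOp (hD : HasBlochRep N D t) {v : Fin 3 → ℝ}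
    (hv : IsState (blochOp v)) : N (blochOp v) = blochOp (D *ᵥ v + t) := by
  refine hD v ?_
  have h := isState_blochOp_iff.mp hv
  rw [← sq_le_one_iff₀ (norm_nonneg _), EuclideanSpace.real_norm_sq_eq] at h
  simpa only [dotProduct, ← sq] using h

theorem IsChannel.norm_mulVec_le_one (hN : IsChannel N) (hD : HasBlochRep N D t)
    {u : BlochSpace} (hu : ‖u‖ ≤ 1) : ‖(WithLp.toLp 2 (D *ᵥ u) : BlochSpace)‖ ≤ 1 := by
  have himage (w : BlochSpace) (hw : ‖w‖ ≤ 1) :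
      ‖(WithLp.toLp 2 (D *ᵥ w + t) : BlochSpace)‖ ≤ 1 := by
    have hstate : IsState (blochOp w) := isState_blochOp_iff.mpr hw
    exact isState_blochOp_iff.mp (hD.map_blochOp hstate ▸ hN.map_isState hstate)
  -- `t` cancels in the difference of the images of two antipodal states.
  have hdiff : (WithLp.toLp 2 (D *ᵥ u) : BlochSpace) =
      (1 / 2 : ℝ) • (WithLp.toLp 2 (D *ᵥ u + t) - WithLp.toLp 2 (D *ᵥ (-u : BlochSpace) + t)) := by
    rw [← WithLp.toLp_sub, add_sub_add_right_eq_sub, ← Matrix.mulVec_sub, WithLp.ofLp_neg,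
      sub_neg_eq_add, ← two_smul ℝ, Matrix.mulVec_smul, WithLp.toLp_smul, smul_smul]
    norm_num
  rw [hdiff, norm_smul, Real.norm_of_nonneg one_half_pos.le]
  linarith [norm_sub_le (WithLp.toLp 2 (D *ᵥ u + t) : BlochSpace)
    (WithLp.toLp 2 (D *ᵥ (-u : BlochSpace) + t)), himage u hu, himage (-u) (by rwa [norm_neg])]

theorem IsChannel.le_one_of_mulVec_eq (hN : IsChannel N) (hD : HasBlochRep N D t)
    {w : Fin 3 → ℝ} (hw : w ≠ 0) {κ : ℝ} (hκ : D *ᵥ w = κ • w) : κ ≤ 1 := by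
  have hw' : (WithLp.toLp 2 w : BlochSpace) ≠ 0 := by simpa using hw
  set u : BlochSpace := NormedSpace.normalize (WithLp.toLp 2 w) with hu
  have hnorm : ‖u‖ = 1 := NormedSpace.norm_normalize hw'
  have heigen : WithLp.toLp 2 (D *ᵥ u) = κ • u := by
    rw [hu, NormedSpace.normalize, WithLp.ofLp_smul, Matrix.mulVec_smul, hκ, smul_comm,
      WithLp.toLp_smul, WithLp.toLp_smul]
  have h := hN.norm_mulVec_le_one hD hnorm.le
  rw [heigen, norm_smul, hnorm, mul_one] at h
  exact (le_abs_self κ).trans h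

end Channel

namespace Ensemble

variable {n : ℕ} {S : Ensemble n} {v : Fin n → Fin 3 → ℝ} {N : QubitOp →ₗ[ℂ] QubitOp}
  {hN : IsChannel N} {D : Matrix (Fin 3) (Fin 3) ℝ} {t : Fin 3 → ℝ} {κ : ℝ}

theorem map_state_eq (hv : ∀ x, S.state x = blochOp (v x)) (hN : IsChannel N)
    (hD : HasBlochRep N D t) (x : Fin n) :
    (S.map N hN).state x = blochOp (D *ᵥ v x + t) :=
  (congrArg N (hv x)).trans (hD.map_blochOp (hv x ▸ S.isState x))

theorem isOptimal_map_iff (hS : S.Equiprobable) (hv : ∀ x, S.state x = blochOp (v x))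
    (hD : HasBlochRep N D t) (hκ : KernelCondition D v κ) {M : Fin n → QubitOp} :
    (S.map N hN).IsOptimal M ↔ S.IsOptimal M :=
  isOptimal_iff_of_sub_eq_smul hS hS hv (map_state_eq hv hN hD) (hκ.sub_eq_smul t) hκ.1.1

theorem isOMP_and_isNontrivial_map (hS : S.Equiprobable) (hv : ∀ x, S.state x = blochOp (v x))
    (hD : HasBlochRep N D t) (hκ : KernelCondition D v κ) :
    S.IsOMP N hN ∧ (S.IsNontrivial → (S.map N hN).IsNontrivial) :=
  ⟨fun _ hM => ⟨hM, (isOptimal_map_iff hS hv hD hκ).mpr hM⟩,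
    fun hnt j hj => hnt j ((isOptimal_map_iff hS hv hD hκ).mp hj)⟩

theorem degradation_eq (hS : S.Equiprobable) (hv : ∀ x, S.state x = blochOp (v x))
    (hD : HasBlochRep N D t) (hκ : KernelCondition D v κ) {M : Fin n → QubitOp}
    (hM : S.IsOptimal M) : S.degradation N hN = (1 - κ) * (S.guessProb - 1 / n) := by
  have hM' : (S.map N hN).IsOptimal M := (isOptimal_map_iff hS hv hD hκ).mpr hM
  rw [degradation, hM.guessProb_eq_blochGain hS hv,
    hM'.guessProb_eq_blochGain hS (map_state_eq hv hN hD),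
    blochGain_eq_mul hM.1 (hκ.sub_eq_smul t)]
  ring

theorem isOMP_of_hasBlochRep_smul_one (hS : S.Equiprobable) (hN : IsChannel N)
    (hκ : κ ∈ Set.Ioc (0 : ℝ) 1) (hD : HasBlochRep N (κ • (1 : Matrix (Fin 3) (Fin 3) ℝ)) t) :
    S.IsOMP N hN ∧ (S.IsNontrivial → (S.map N hN).IsNontrivial) := by
  obtain ⟨v, hv⟩ := S.exists_blochOp
  exact isOMP_and_isNontrivial_map hS hv hD (kernelCondition_smul_one hκ v)

theorem Preserves.exists_kernelCondition {M : Fin n → QubitOp} (hM : S.Preserves N hN M)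
    (hS : S.Equiprobable) (hv : ∀ x, S.state x = blochOp (v x)) (hD : HasBlochRep N D t)
    (hnt : S.IsNontrivial) (hnt' : (S.map N hN).IsNontrivial) (hne : ∀ x, M x ≠ 0) :
    ∃ κ : ℝ, KernelCondition D v κ := by
  have hw := map_state_eq hv hN hD
  set F := blochGain v M
  set G := blochGain (fun x => D *ᵥ v x + t) M
  have hF : 0 < F := hnt.blochGain_pos hS hv hM.1
  have hG : 0 < G := hnt'.blochGain_pos hS hw hM.2
  have hker (x y : Fin n) : D *ᵥ (v x - v y) = (G / F) • (v x - v y) := by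
    apply WithLp.toLp_injective 2
    have hdiff' := hM.2.sub_eq_smul_normalize_sub hS hw hnt' hne x y
    rw [← WithLp.toLp_sub, add_sub_add_right_eq_sub, ← Matrix.mulVec_sub] at hdiff'
    rw [hdiff', WithLp.toLp_smul, WithLp.toLp_sub,
      hM.1.sub_eq_smul_normalize_sub hS hv hnt hne x y, smul_smul, div_mul_cancel₀ _ hF.ne']
  by_cases hex : ∃ x y, v x ≠ v y
  · obtain ⟨x, y, hxy⟩ := hex
    have hle := hN.le_one_of_mulVec_eq hD (sub_ne_zero.mpr hxy) (hker x y)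
    exact ⟨G / F, kernelCondition_iff.mpr ⟨⟨div_pos hG hF, hle⟩, hker⟩⟩
  · push Not at hex
    exact ⟨1, kernelCondition_iff.mpr ⟨⟨one_pos, le_rfl⟩, fun x y => by simp [hex x y]⟩⟩

end Ensemble

theorem isCompletelyPositive_id : IsCompletelyPositive LinearMap.id := fun _ _ hX => hX

namespace IsCompletelyPositive

variable {N N' : QubitOp →ₗ[ℂ] QubitOp}

theorem add (hN : IsCompletelyPositive N) (hN' : IsCompletelyPositive N') :
    IsCompletelyPositive (N + N') := fun k X hX => (hN k X hX).add (hN' k X hX)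

theorem smul (hN : IsCompletelyPositive N) {c : ℂ} (hc : 0 ≤ c) :
    IsCompletelyPositive (c • N) := fun k X hX => (hN k X hX).smul hc

end IsCompletelyPositive

open scoped Kronecker in
theorem isCompletelyPositive_trace_smulRight {P : QubitOp} (hP : P.PosSemidef) :
    IsCompletelyPositive ((Matrix.traceLinearMap (Fin 2) ℂ ℂ).smulRight P) := by
  intro k X hX
  have hpartial : (∑ a : Fin 2, X.submatrix (·, a) (·, a)).PosSemidef :=
    Matrix.posSemidef_sum _ fun a _ => hX.submatrix _
  refine (congrArg Matrix.PosSemidef ?_).mpr (hpartial.kronecker hP)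
  ext p q
  simp [Matrix.trace, Matrix.kroneckerMap_apply]

theorem isChannel_depolarizing {η : ℝ} (h0 : 0 ≤ η) (h1 : η ≤ 1) :
    IsChannel (depolarizing η) where
  completelyPositive := by
    refine (isCompletelyPositive_id.smul ?_).add
      ((isCompletelyPositive_trace_smulRight .one).smul ?_)
    · exact Complex.zero_le_real.mpr (sub_nonneg.mpr h1)
    · exact Complex.zero_le_real.mpr (div_nonneg h0 zero_le_two)
  tracePreserving X := by
    simp only [depolarizing, LinearMap.add_apply, LinearMap.smul_apply, LinearMap.id_apply,
      LinearMap.smulRight_apply, Matrix.traceLinearMap_apply, Matrix.trace_add,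
      Matrix.trace_smul, Matrix.trace_one, Fintype.card_fin, smul_eq_mul]
    push_cast
    ring

theorem hasBlochRep_depolarizing (η : ℝ) :
    HasBlochRep (depolarizing η) ((1 - η) • (1 : Matrix (Fin 3) (Fin 3) ℝ)) 0 := by
  intro v _
  rw [Matrix.smul_mulVec, Matrix.one_mulVec, add_zero]
  ext i j
  fin_cases i <;> fin_cases j <;>
    simp [depolarizing, blochOp, pauli, Fin.sum_univ_three, Matrix.trace_fin_two] <;> ring

theorem proposition2 {n : ℕ} (S : Ensemble n) (hS : S.Equiprobable) :
    -- characterization, for a nontrivial problem in which every state is identified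
    (S.IsNontrivial → S.AllIdentified →
      ∀ v : Fin n → Fin 3 → ℝ, (∀ x, S.state x = blochOp (v x)) →
      ∀ (N : QubitOp →ₗ[ℂ] QubitOp) (hN : IsChannel N)
        (D : Matrix (Fin 3) (Fin 3) ℝ) (t : Fin 3 → ℝ), HasBlochRep N D t →
        -- preservation of all optimal measurements
        ((S.IsOMP N hN ∧ (S.map N hN).IsNontrivial) ↔ ∃ κ : ℝ, KernelCondition D v κ) ∧
        -- preservation of one given optimal measurement that identifies all the states
        (∀ M : Fin n → QubitOp, S.IsOptimal M → (∀ x, M x ≠ 0) →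
          ((S.Preserves N hN M ∧ (S.map N hN).IsNontrivial) ↔
            ∃ κ : ℝ, KernelCondition D v κ)) ∧
        -- the value of `κ`
        1 / (n : ℝ) < S.guessProb ∧
        (∀ κ : ℝ, KernelCondition D v κ →
          κ = 1 - S.degradation N hN / (S.guessProb - 1 / (n : ℝ)) ∧
          (S.guessProb = 2 / (n : ℝ) → κ = 1 - n * S.degradation N hN))) ∧
    -- channels of the form `v ↦ κ v + t`
    (∀ (κ : ℝ) (t : Fin 3 → ℝ) (Λ : QubitOp →ₗ[ℂ] QubitOp) (hΛ : IsChannel Λ),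
      κ ∈ Set.Ioc (0 : ℝ) 1 → HasBlochRep Λ (κ • (1 : Matrix (Fin 3) (Fin 3) ℝ)) t →
      S.IsOMP Λ hΛ ∧ (S.IsNontrivial → (S.map Λ hΛ).IsNontrivial)) ∧
    -- depolarizing channels
    (∀ η : ℝ, η ∈ Set.Ico (0 : ℝ) 1 → ∃ hη : IsChannel (depolarizing η),
      HasBlochRep (depolarizing η) ((1 - η) • (1 : Matrix (Fin 3) (Fin 3) ℝ)) 0 ∧
      S.IsOMP (depolarizing η) hη ∧
      (S.IsNontrivial → (S.map (depolarizing η) hη).IsNontrivial)) := by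
  refine ⟨fun hnt hall v hv N hN D t hD => ?_, fun κ t Λ hΛ hκ hD => ?_, fun η hη => ?_⟩
  · obtain ⟨M₀, hM₀, hne₀⟩ := hall.exists_isOptimal
    have sufficiency : (∃ κ, KernelCondition D v κ) →
        S.IsOMP N hN ∧ (S.map N hN).IsNontrivial := fun ⟨_, hκ⟩ =>
      (Ensemble.isOMP_and_isNontrivial_map hS hv hD hκ).imp_right (· hnt)
    have hlt : 1 / (n : ℝ) < S.guessProb := hnt.one_div_lt_guessProb hS hM₀
    refine ⟨⟨fun h => (h.1 M₀ hM₀).exists_kernelCondition hS hv hD hnt h.2 hne₀, sufficiency⟩,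
      fun M hM hne => ⟨fun h => h.1.exists_kernelCondition hS hv hD hnt h.2 hne,
        fun h => (sufficiency h).imp_left (· M hM)⟩, hlt, fun κ hκ => ?_⟩
    rw [Ensemble.degradation_eq hS hv hD hκ hM₀]
    have hn : (n : ℝ) ≠ 0 := Nat.cast_ne_zero.mpr S.card_pos.ne'
    refine ⟨?_, fun h2 => ?_⟩
    · rw [mul_div_cancel_right₀ _ (sub_pos.mpr hlt).ne', sub_sub_cancel]
    · rw [h2]
      field_simp
      ring
  · exact Ensemble.isOMP_of_hasBlochRep_smul_one hS hΛ hκ hD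
  · have hrep := hasBlochRep_depolarizing η
    exact ⟨isChannel_depolarizing hη.1 hη.2.le, hrep, Ensemble.isOMP_of_hasBlochRep_smul_one hS _
      ⟨sub_pos.mpr hη.2, sub_le_self 1 hη.1⟩ hrep⟩
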